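/- Let $n\in\mathbb N$, $n\ge 2$, and $s\in(0,1)$. Let $\Omega\subset\mathbb R^n$ be a bounded Lipschitz domain, i.e. a bounded open set (not necessarily connected) which near each of its boundary points coincides, after a rigid motion, with the hypograph $\{(y',y_n)\in\mathbb R^{n-1}\times\mathbb R : y_n<\varphi(y')\}$ of a Lipschitz function $\varphi:\mathbb R^{n-1}\to\mathbb R$. Let $u:\mathbb R^n\to\mathbb R$ belong to $C^2(\Omega)\cap C(\mathbb R^n)$, vanish outside $\Omega$, and have first-order partial derivatives $\partial u/\partial x_i$, $1\le i\le n$, that are integrable in $\Omega$. Let $$(-\Delta)^s u(x)=c_{n,s}\,\lim_{\varepsilon\to0^+}\int_{|x-y|\ge\varepsilon}\frac{u(x)-u(y)}{|x-y|^{n+2s}}\,dy,\qquad c_{n,s}=\frac{2^{2s}\,s\,\Gamma\left(s+\frac n2\right)}{\pi^{n/2}\,\Gamma(1-s)},$$ denote the fractional Laplacian. Then for every $x\in\mathbb R^n\setminus\partial\Omega$ the integrals and the limit defining $(-\Delta)^s u(x)$ exist, the integral $\int_\Omega u(y)|x-y|^{2-n-2s}\,dy$ converges absolutely and is a $C^2$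 function in a neighborhood of $x$, and $$(-\Delta)^s u(x)=C_{n,s}\,\Delta_x\int_\Omega\frac{u(y)}{|x-y|^{n+2s-2}}\,dy,\qquad C_{n,s}=-\frac{\Gamma\left(s+\frac n2-1\right)\Gamma(s)}{4^{1-s}\,\pi^{\frac n2+1}}\,\sin(\pi s).$$ -/

import Mathlib

open MeasureTheory Filter Topology
open scoped NNReal

/-- `Ω ⊆ ℝⁿ` is a bounded Lipschitz domain: it is open and bounded and, near each of its boundary
points, after a rigid motion `κ` of `ℝⁿ` onto `ℝⁿ⁻¹ × ℝ`, it coincides with the hypograph of a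
Lipschitz function `φ : ℝⁿ⁻¹ → ℝ`. (Connectedness is not required. Since the boundary is compact,
finitely many of the neighbourhoods `W` cover it.) -/
def IsBoundedLipschitzDomain {n : ℕ} (Ω : Set (EuclideanSpace ℝ (Fin n))) : Prop :=
  IsOpen Ω ∧ Bornology.IsBounded Ω ∧
    ∀ z ∈ frontier Ω,
      ∃ W : Set (EuclideanSpace ℝ (Fin n)), IsOpen W ∧ z ∈ W ∧
      ∃ κ : EuclideanSpace ℝ (Fin n) ≃ᵃⁱ[ℝ] WithLp 2 (EuclideanSpace ℝ (Fin (n - 1)) × ℝ),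
      ∃ (K : ℝ≥0) (φ : EuclideanSpace ℝ (Fin (n - 1)) → ℝ), LipschitzWith K φ ∧
        ∀ y ∈ W, (y ∈ Ω ↔ (κ y).snd < φ (κ y).fst)

/-- The normalising constant `c_{n,s}` of the fractional Laplacian. -/
noncomputable def fracLapConst (n : ℕ) (s : ℝ) : ℝ :=
  (2 : ℝ) ^ (2 * s) * s * Real.Gamma (s + (n : ℝ) / 2) /
    (Real.pi ^ ((n : ℝ) / 2) * Real.Gamma (1 - s))

/-- `(-Δ)^s u (x)` exists and equals `L`, where
`(-Δ)^s u (x) = c_{n,s} P.V. ∫_{ℝⁿ} (u x - u y) / |x - y|^{n+2s} dy`: the integrals over the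
complements of the balls `B_ε(x)` converge absolutely, and `c_{n,s}` times these integrals tends
to `L` as `ε → 0⁺`. -/
def HasFracLaplacianAt {n : ℕ} (s : ℝ) (u : EuclideanSpace ℝ (Fin n) → ℝ)
    (x : EuclideanSpace ℝ (Fin n)) (L : ℝ) : Prop :=
  (∀ ε : ℝ, 0 < ε →
    IntegrableOn (fun y => (u x - u y) / ‖x - y‖ ^ ((n : ℝ) + 2 * s)) (Metric.ball x ε)ᶜ) ∧
  Tendsto
    (fun ε : ℝ => fracLapConst n s *
      ∫ y in (Metric.ball x ε)ᶜ, (u x - u y) / ‖x - y‖ ^ ((n : ℝ) + 2 * s))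
    (𝓝[>] 0) (𝓝 L)

/-- The constant `C_{n,s}` in front of the Laplacian of the weakly singular potential. -/
noncomputable def weakConst (n : ℕ) (s : ℝ) : ℝ :=
  -(Real.Gamma (s + (n : ℝ) / 2 - 1) * Real.Gamma s /
      ((4 : ℝ) ^ (1 - s) * Real.pi ^ ((n : ℝ) / 2 + 1))) * Real.sin (Real.pi * s)

/-- The weakly singular potential `x ↦ ∫_Ω u(y) / |x - y|^{n+2s-2} dy`. -/
noncomputable def weakPotential {n : ℕ} (s : ℝ) (Ω : Set (EuclideanSpace ℝ (Fin n)))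
    (u : EuclideanSpace ℝ (Fin n) → ℝ) (x : EuclideanSpace ℝ (Fin n)) : ℝ :=
  ∫ y in Ω, u y / ‖x - y‖ ^ ((n : ℝ) + 2 * s - 2)

/-! Put `a = n + 2s - 2`, so that `0 < a < n < a + 2`. Away from the origin `Δ ‖z‖^(-a) = a (a + 2 -
n) ‖z‖^(-(a + 2))`, and `a + 2 = n + 2s` is the exponent of the fractional Laplacian. The right side
is not locally integrable, so Δ cannot simply be moved under the integral. The cure is to pair it
with the second difference `u(x+z) + u(x-z) - 2u(x) = O(‖z‖²)`. Both sides of the theorem are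
multiples of the absolutely convergent integral `I` of `‖z‖^(-(n+2s))` times this difference.

For the potential (`contDiffAt_and_laplacian_potential`), write `u = v + w` with `v` globally C² and
`w` zero near `x`. The `w` part sees the kernel only away from its singularity. For `v`, Δ is moved
onto `v`, the kernel is smoothed to `(‖z‖² + c)^(-a/2)`, and two integrations by parts bring Δ back
to the kernel. The smoothed kernel's Laplacian is even with total integral zero, so the second
difference appears for free, and `c → 0` is a dominated limit (`integral_norm_rpow_mul_laplacian`).

For the principal value (`tendsto_setIntegral_sub_div_norm_rpow`), averaging over `z` and `-z` gives
`-I/2`. The constants then match by the recurrence and reflection formulas for Γ. -/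

open scoped Laplacian Convolution
open Module (finrank)

/-! ### Laplacians, convolution and integration by parts -/

section Laplacian

variable {E : Type*} [NormedAddCommGroup E] [InnerProductSpace ℝ E]

theorem fderiv_fderiv_apply_const {f : E → ℝ} {x : E} (hf : ContDiffAt ℝ 2 f x) (v w : E) :
    fderiv ℝ (fun y => fderiv ℝ f y v) x w = fderiv ℝ (fderiv ℝ f) x w v := by
  have h : DifferentiableAt ℝ (fderiv ℝ f) x :=
    (hf.fderiv_right (m := 1) (by norm_num)).differentiableAt (by norm_num)
  rw [fderiv_clm_apply h (differentiableAt_const v)]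
  simp

theorem ContDiff.fderiv_apply_const {f : E → ℝ} (hf : ContDiff ℝ 2 f) (v : E) :
    ContDiff ℝ 1 fun y => fderiv ℝ f y v :=
  (hf.fderiv_right (m := 1) (by norm_num)).clm_apply contDiff_const

theorem ContDiff.continuous_fderiv_fderiv_apply {f : E → ℝ} (hf : ContDiff ℝ 2 f) (v w : E) :
    Continuous fun x => fderiv ℝ (fun y => fderiv ℝ f y v) x w :=
  ((hf.fderiv_apply_const v).continuous_fderiv (by norm_num)).clm_apply continuous_const

variable [FiniteDimensional ℝ E]

theorem laplacian_eq_sum_fderiv {f : E → ℝ} {x : E} (hf : ContDiffAt ℝ 2 f x) :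
    Δ f x = ∑ i, fderiv ℝ (fun y => fderiv ℝ f y (stdOrthonormalBasis ℝ E i)) x
      (stdOrthonormalBasis ℝ E i) := by
  rw [InnerProductSpace.laplacian_eq_iteratedFDeriv_stdOrthonormalBasis]
  refine Finset.sum_congr rfl fun i _ => ?_
  rw [fderiv_fderiv_apply_const hf, iteratedFDeriv_two_apply]
  simp

theorem ContDiff.continuous_laplacian {f : E → ℝ} (hf : ContDiff ℝ 2 f) : Continuous (Δ f) := by
  have : Δ f = fun x => ∑ i, fderiv ℝ (fun y => fderiv ℝ f y (stdOrthonormalBasis ℝ E i)) x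
      (stdOrthonormalBasis ℝ E i) := funext fun x => laplacian_eq_sum_fderiv hf.contDiffAt
  rw [this]
  exact continuous_finsetSum _ fun i _ => hf.continuous_fderiv_fderiv_apply _ _

theorem HasCompactSupport.laplacian {f : E → ℝ} (hc : HasCompactSupport f) :
    HasCompactSupport (Δ f) := by
  refine hc.mono' fun x hx => ?_
  by_contra hxs
  refine hx ?_
  have h : f =ᶠ[𝓝 x] fun _ => 0 :=
    notMem_tsupport_iff_eventuallyEq.1 hxs
  rw [(InnerProductSpace.laplacian_congr_nhds h).self_of_nhds]
  simp

variable [MeasurableSpace E] [BorelSpace E] {μ : Measure E} [μ.IsAddHaarMeasure]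

theorem fderiv_convolution_mul_apply {f g : E → ℝ} (hf : LocallyIntegrable f μ)
    (hg : ContDiff ℝ 1 g) (hc : HasCompactSupport g) (x v : E) :
    fderiv ℝ (f ⋆[ContinuousLinearMap.mul ℝ ℝ, μ] g) x v =
      (f ⋆[ContinuousLinearMap.mul ℝ ℝ, μ] fun y => fderiv ℝ g y v) x := by
  rw [(hc.hasFDerivAt_convolution_right (ContinuousLinearMap.mul ℝ ℝ) hf hg x).fderiv]
  exact convolution_precompR_apply _ hf (hc.fderiv ℝ) (hg.continuous_fderiv one_ne_zero) x v

/-- All derivatives fall on the regular factor, so `f` may be a singular kernel or a merely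
continuous function. -/
theorem laplacian_convolution_mul {f g : E → ℝ} (hf : LocallyIntegrable f μ)
    (hg : ContDiff ℝ 2 g) (hc : HasCompactSupport g) (x : E) :
    Δ (f ⋆[ContinuousLinearMap.mul ℝ ℝ, μ] g) x = ∫ t, f t * Δ g (x - t) ∂μ := by
  have h2 : ContDiff ℝ 2 (f ⋆[ContinuousLinearMap.mul ℝ ℝ, μ] g) :=
    hc.contDiff_convolution_right (n := 2) _ hf hg
  rw [laplacian_eq_sum_fderiv h2.contDiffAt]
  simp_rw [laplacian_eq_sum_fderiv hg.contDiffAt, Finset.mul_sum]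
  rw [integral_finsetSum]
  · refine Finset.sum_congr rfl fun i _ => ?_
    have h1 : (fun y => fderiv ℝ (f ⋆[ContinuousLinearMap.mul ℝ ℝ, μ] g) y
        (stdOrthonormalBasis ℝ E i)) = (f ⋆[ContinuousLinearMap.mul ℝ ℝ, μ]
          fun y => fderiv ℝ g y (stdOrthonormalBasis ℝ E i)) :=
      funext fun y => fderiv_convolution_mul_apply hf (hg.of_le (by norm_num)) hc y _
    rw [h1, fderiv_convolution_mul_apply hf (hg.fderiv_apply_const _) (hc.fderiv_apply ℝ _)]
    rfl
  · intro i _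
    exact ((hc.fderiv_apply ℝ _).fderiv_apply ℝ _).convolutionExists_right
      (ContinuousLinearMap.mul ℝ ℝ) hf (hg.continuous_fderiv_fderiv_apply _ _) x

/-- Two integrations by parts in each basis direction. Compact support of `g` alone removes the
boundary terms, so `f` can be the smoothed kernel. -/
theorem integral_mul_laplacian {f g : E → ℝ} (hf : ContDiff ℝ 2 f) (hg : ContDiff ℝ 2 g)
    (hc : HasCompactSupport g) : ∫ x, f x * Δ g x ∂μ = ∫ x, Δ f x * g x ∂μ := by
  have key : ∀ v : E, ∫ x, f x * fderiv ℝ (fun y => fderiv ℝ g y v) x v ∂μ =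
      ∫ x, fderiv ℝ (fun y => fderiv ℝ f y v) x v * g x ∂μ := by
    intro v
    have hf1 := hf.fderiv_apply_const v
    have hg1 := hg.fderiv_apply_const v
    have hc1 := hc.fderiv_apply ℝ v
    have hf0 := hf.continuous
    have hg0 := hg.continuous
    have hf2 := hf.continuous_fderiv_fderiv_apply v v
    have hg2 := hg.continuous_fderiv_fderiv_apply v v
    have i1 : Integrable (fun x => fderiv ℝ f x v * fderiv ℝ g x v) μ :=
      (hf1.continuous.mul hg1.continuous).integrable_of_hasCompactSupport hc1.mul_left
    rw [integral_mul_fderiv_eq_neg_fderiv_mul_of_integrable i1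
      ((hf0.mul hg2).integrable_of_hasCompactSupport (hc1.fderiv_apply ℝ v).mul_left)
      ((hf0.mul hg1.continuous).integrable_of_hasCompactSupport hc1.mul_left)
      (fun x _ => hf.differentiable (by norm_num) x)
      (fun x _ => hg1.differentiable (by norm_num) x),
      integral_mul_fderiv_eq_neg_fderiv_mul_of_integrable
      ((hf2.mul hg0).integrable_of_hasCompactSupport hc.mul_left) i1
      ((hf1.continuous.mul hg0).integrable_of_hasCompactSupport hc.mul_left)
      (fun x _ => hf1.differentiable (by norm_num) x)
      (fun x _ => hg.differentiable (by norm_num) x), neg_neg]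
  simp_rw [laplacian_eq_sum_fderiv hg.contDiffAt, laplacian_eq_sum_fderiv hf.contDiffAt,
    Finset.mul_sum, Finset.sum_mul]
  rw [integral_finsetSum, integral_finsetSum]
  · exact Finset.sum_congr rfl fun i _ => key _
  · intro i _
    exact ((hf.continuous_fderiv_fderiv_apply _ _).mul
      hg.continuous).integrable_of_hasCompactSupport hc.mul_left
  · intro i _
    exact (hf.continuous.mul
      (hg.continuous_fderiv_fderiv_apply _ _)).integrable_of_hasCompactSupport
      ((hc.fderiv_apply ℝ _).fderiv_apply ℝ _).mul_left

end Laplacian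

/-! ### Derivatives of powers of `‖z‖² + c` -/

section RadialPower

variable {E : Type*} [NormedAddCommGroup E] [InnerProductSpace ℝ E]

theorem hasFDerivAt_norm_sq_add_rpow {c q : ℝ} {z : E} (hz : 0 < ‖z‖ ^ 2 + c) :
    HasFDerivAt (fun y : E => (‖y‖ ^ 2 + c) ^ q)
      ((q * (‖z‖ ^ 2 + c) ^ (q - 1)) • ((2 : ℝ) • innerSL ℝ z)) z := by
  have h1 : HasFDerivAt (fun y : E => ‖y‖ ^ 2 + c) ((2 : ℝ) • innerSL ℝ z) z := by
    simpa [two_smul] using (hasStrictFDerivAt_norm_sq z).hasFDerivAt.add_const c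
  exact h1.rpow_const (Or.inl hz.ne')

theorem contDiffAt_norm_sq_add_rpow {c q : ℝ} {z : E} (hz : 0 < ‖z‖ ^ 2 + c) {m : WithTop ℕ∞} :
    ContDiffAt ℝ m (fun y : E => (‖y‖ ^ 2 + c) ^ q) z :=
  ((contDiff_norm_sq ℝ).contDiffAt.add contDiffAt_const).rpow_const_of_ne hz.ne'

theorem fderiv_fderiv_norm_sq_add_rpow {c q : ℝ} {z : E} (hz : 0 < ‖z‖ ^ 2 + c) (v : E) :
    fderiv ℝ (fun x : E => fderiv ℝ (fun y : E => (‖y‖ ^ 2 + c) ^ q) x v) z v =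
      2 * q * (‖z‖ ^ 2 + c) ^ (q - 2) *
        (2 * (q - 1) * inner ℝ z v ^ 2 + (‖z‖ ^ 2 + c) * ‖v‖ ^ 2) := by
  have hnear : ∀ᶠ x in 𝓝 z, 0 < ‖x‖ ^ 2 + c :=
    (by fun_prop : Continuous fun x : E => ‖x‖ ^ 2 + c).continuousAt.eventually (lt_mem_nhds hz)
  have h1 : (fun x : E => fderiv ℝ (fun y : E => (‖y‖ ^ 2 + c) ^ q) x v) =ᶠ[𝓝 z]
      fun x => 2 * q * ((‖x‖ ^ 2 + c) ^ (q - 1) * inner ℝ x v) := by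
    filter_upwards [hnear] with x hx
    rw [(hasFDerivAt_norm_sq_add_rpow hx).fderiv]
    simp only [smul_apply, innerSL_apply_apply, smul_eq_mul]
    ring
  have h2 : HasFDerivAt (fun x : E => inner ℝ x v) (innerSL ℝ v) z := by
    have := (innerSL ℝ v).hasFDerivAt (x := z)
    refine this.congr_of_eventuallyEq (Eventually.of_forall fun x => ?_)
    simp [real_inner_comm]
  have h3 : HasFDerivAt (fun x : E => 2 * q * ((‖x‖ ^ 2 + c) ^ (q - 1) * inner ℝ x v)) _ z :=
    ((hasFDerivAt_norm_sq_add_rpow (q := q - 1) hz).mul h2).const_mul _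
  rw [h1.fderiv_eq, h3.fderiv]
  simp only [smul_apply, innerSL_apply_apply, smul_eq_mul,
    add_apply, real_inner_self_eq_norm_sq]
  have e1 : (‖z‖ ^ 2 + c) ^ (q - 1) = (‖z‖ ^ 2 + c) ^ (q - 2) * (‖z‖ ^ 2 + c) := by
    rw [← Real.rpow_add_one hz.ne']; ring_nf
  rw [show q - 1 - 1 = q - 2 by ring, e1]
  ring

theorem laplacian_norm_sq_add_rpow [FiniteDimensional ℝ E] {c q : ℝ} {z : E}
    (hz : 0 < ‖z‖ ^ 2 + c) :
    Δ (fun y : E => (‖y‖ ^ 2 + c) ^ q) z =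
      2 * q * (‖z‖ ^ 2 + c) ^ (q - 2) *
        ((finrank ℝ E + 2 * (q - 1)) * ‖z‖ ^ 2 + finrank ℝ E * c) := by
  rw [laplacian_eq_sum_fderiv (contDiffAt_norm_sq_add_rpow hz)]
  simp_rw [fderiv_fderiv_norm_sq_add_rpow hz]
  rw [← Finset.mul_sum, Finset.sum_add_distrib, ← Finset.mul_sum,
    (stdOrthonormalBasis ℝ E).sum_sq_inner_left]
  simp only [OrthonormalBasis.norm_eq_one, one_pow, mul_one, Finset.sum_const, Finset.card_univ,
    Fintype.card_fin, nsmul_eq_mul]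
  ring

theorem norm_sq_rpow_neg_half {F : Type*} [SeminormedAddCommGroup F] (z : F) (p : ℝ) : (‖z‖ ^ 2 + 0) ^ (-p / 2) = ‖z‖ ^ (-p) := by
  rw [add_zero, ← Real.rpow_natCast, ← Real.rpow_mul (norm_nonneg z)]
  congr 1
  push_cast
  ring

end RadialPower

/-! ### Laplacian after a point reflection -/

section Reflection

variable {E : Type*} [NormedAddCommGroup E] [InnerProductSpace ℝ E]

theorem fderiv_comp_const_sub {f : E → ℝ} (hf : Differentiable ℝ f) (x z : E) :
    fderiv ℝ (fun y => f (x - y)) z = -fderiv ℝ f (x - z) := by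
  have h : HasFDerivAt (fun y => x - y) (-ContinuousLinearMap.id ℝ E) z := by
    simpa using! (hasFDerivAt_id z).const_sub x
  have := ((hf (x - z)).hasFDerivAt.comp z h).fderiv
  rw [Function.comp_def] at this
  rw [this]
  ext v
  simp

theorem laplacian_comp_const_sub [FiniteDimensional ℝ E] {f : E → ℝ} (hf : ContDiff ℝ 2 f)
    (x z : E) : Δ (fun y => f (x - y)) z = Δ f (x - z) := by
  have hs : ContDiff ℝ 2 fun y => f (x - y) := hf.comp (contDiff_const.sub contDiff_id)
  rw [laplacian_eq_sum_fderiv hs.contDiffAt, laplacian_eq_sum_fderiv hf.contDiffAt]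
  refine Finset.sum_congr rfl fun i _ => ?_
  have h1 : (fun y => fderiv ℝ (fun y => f (x - y)) y (stdOrthonormalBasis ℝ E i)) =
      fun y => -(fun t => fderiv ℝ f t (stdOrthonormalBasis ℝ E i)) (x - y) := by
    ext y
    rw [fderiv_comp_const_sub (hf.differentiable (by norm_num))]
    rfl
  rw [h1, fderiv_fun_neg,
    fderiv_comp_const_sub ((hf.fderiv_apply_const _).differentiable (by norm_num)), neg_neg]

end Reflection

/-! ### Second differences are quadratically small -/

section SecondDifference

variable {E : Type*} [NormedAddCommGroup E]

/-- The symmetric second difference `f (x + z) + f (x - z) - 2 f x`. -/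
def secondDifference (f : E → ℝ) (x z : E) : ℝ := f (x + z) + f (x - z) - 2 * f x

theorem Continuous.secondDifference {f : E → ℝ} (hf : Continuous f) (x : E) :
    Continuous (secondDifference f x) := by
  unfold _root_.secondDifference
  fun_prop

theorem abs_secondDifference_le {f : E → ℝ} {M : ℝ} (hM : ∀ y, |f y| ≤ M) (x z : E) :
    |secondDifference f x z| ≤ 4 * M := by
  have h1 := abs_le.1 (hM (x + z))
  have h2 := abs_le.1 (hM (x - z))
  have h3 := abs_le.1 (hM x)
  rw [secondDifference, abs_le]
  constructor <;> linarith

/-- The map `z ↦ f (x + z) + f (x - z)` has derivative `f'(x + z) - f'(x - z)`, of size at most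
`2K‖z‖` because `f'` is Lipschitz near `x`; the mean value inequality supplies the other factor
`‖z‖`. -/
theorem exists_abs_secondDifference_le [NormedSpace ℝ E] {f : E → ℝ} {x : E}
    (hf : ContDiffAt ℝ 2 f x) :
    ∃ δ > 0, ∃ C, ∀ z, ‖z‖ < δ → |secondDifference f x z| ≤ C * ‖z‖ ^ 2 := by
  have h1 : ContDiffAt ℝ 1 (fderiv ℝ f) x := hf.fderiv_right (m := 1) (by norm_num)
  obtain ⟨K, t, ht, hK⟩ := h1.exists_lipschitzOnWith
  have hd : ∀ᶠ y in 𝓝 x, DifferentiableAt ℝ f y := by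
    filter_upwards [hf.eventually (by simp)] with y hy using hy.differentiableAt (by norm_num)
  obtain ⟨δ, hδ, hball⟩ := Metric.mem_nhds_iff.1 (inter_mem ht hd)
  refine ⟨δ, hδ, 2 * K, fun z hz => ?_⟩
  have hmem : ∀ y ∈ Metric.closedBall (0 : E) ‖z‖, x + y ∈ Metric.ball x δ ∧
      x - y ∈ Metric.ball x δ := by
    intro y hy
    have : ‖y‖ ≤ ‖z‖ := by simpa using hy
    simp only [Metric.mem_ball, dist_eq_norm, add_sub_cancel_left, sub_sub_cancel_left, norm_neg,
      and_self]
    exact this.trans_lt hz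
  have hderiv : ∀ y ∈ Metric.closedBall (0 : E) ‖z‖,
      HasFDerivWithinAt (fun y => f (x + y) + f (x - y)) (fderiv ℝ f (x + y) - fderiv ℝ f (x - y))
        (Metric.closedBall (0 : E) ‖z‖) y := by
    intro y hy
    have e1 : HasFDerivAt (fun y => x + y) (ContinuousLinearMap.id ℝ E) y := by
      simpa using! (hasFDerivAt_id y).const_add x
    have e2 : HasFDerivAt (fun y => x - y) (-ContinuousLinearMap.id ℝ E) y := by
      simpa using! (hasFDerivAt_id y).const_sub x
    have h3 := (hball (hmem y hy).1).2.hasFDerivAt.comp y e1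
    have h4 := (hball (hmem y hy).2).2.hasFDerivAt.comp y e2
    convert! (h3.add h4).hasFDerivWithinAt using 1
    ext v
    simp [sub_eq_add_neg]
  have hbound : ∀ y ∈ Metric.closedBall (0 : E) ‖z‖,
      ‖fderiv ℝ f (x + y) - fderiv ℝ f (x - y)‖ ≤ 2 * K * ‖z‖ := by
    intro y hy
    have hy' : ‖y‖ ≤ ‖z‖ := by simpa using hy
    have h5 := hK.dist_le_mul _ (hball (hmem y hy).1).1 _ (hball (hmem y hy).2).1
    rw [dist_eq_norm, dist_eq_norm, show x + y - (x - y) = y + y by abel] at h5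
    calc _ ≤ K * ‖y + y‖ := h5
      _ ≤ K * (‖z‖ + ‖z‖) := by gcongr; exact (norm_add_le _ _).trans (by gcongr)
      _ = _ := by ring
  have := (convex_closedBall (0 : E) ‖z‖).norm_image_sub_le_of_norm_hasFDerivWithin_le hderiv hbound
    (Metric.mem_closedBall_self (norm_nonneg z)) (show z ∈ _ by simp)
  simp only [add_zero, sub_zero, Real.norm_eq_abs] at this
  calc |secondDifference f x z| = |f (x + z) + f (x - z) - (f x + f x)| := by
        rw [secondDifference]; ring_nf
    _ ≤ _ := this
    _ = _ := by ring

end SecondDifference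

/-! ### Integrability of power kernels -/

section PowerIntegrability

variable {E : Type*} [NormedAddCommGroup E] [NormedSpace ℝ E] [FiniteDimensional ℝ E]
  [MeasurableSpace E] [BorelSpace E] {μ : Measure E} [μ.IsAddHaarMeasure]

theorem integrableOn_norm_rpow_compl_ball {b δ : ℝ} (hb : finrank ℝ E < b) (hδ : 0 < δ) :
    IntegrableOn (fun z : E => ‖z‖ ^ (-b)) (Metric.ball 0 δ)ᶜ μ := by
  have hb0 : 0 < b := lt_of_le_of_lt (Nat.cast_nonneg _) hb
  -- The constant comes from `1 + ‖z‖ ≤ (δ⁻¹ + 1) ‖z‖` for `‖z‖ ≥ δ`.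
  have hi : Integrable (fun z : E => (δ⁻¹ + 1) ^ b * (1 + ‖z‖) ^ (-b)) μ :=
    (integrable_one_add_norm hb).const_mul _
  refine hi.integrableOn.mono' (measurable_norm.pow_const _).aestronglyMeasurable ?_
  filter_upwards [ae_restrict_mem Metric.isOpen_ball.measurableSet.compl] with z hz
  have hz : δ ≤ ‖z‖ := by simpa using hz
  have hz0 : 0 < ‖z‖ := hδ.trans_le hz
  rw [Real.norm_of_nonneg (by positivity), Real.rpow_neg hz0.le, Real.rpow_neg (by positivity),
    ← div_eq_mul_inv, inv_eq_one_div, div_le_div_iff₀ (by positivity) (by positivity), one_mul,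
    ← Real.mul_rpow (by positivity) hz0.le]
  refine Real.rpow_le_rpow (by positivity) ?_ hb0.le
  have : 1 ≤ δ⁻¹ * ‖z‖ := by rw [inv_mul_eq_div, le_div_iff₀ hδ]; linarith
  linarith

theorem locallyIntegrable_norm_rpow_neg (hd : 1 ≤ finrank ℝ E) {a : ℝ} (ha : a < finrank ℝ E) :
    LocallyIntegrable (fun z : E => ‖z‖ ^ (-a)) μ :=
  locallyIntegrable_of_norm_le_rpow hd (C := 1) ha (Eventually.of_forall fun z => by
    rw [Real.norm_of_nonneg (by positivity), one_mul])
    (measurable_norm.pow_const _).aestronglyMeasurable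

/-- Near the origin the quadratic decay of `S` lowers the exponent to `b - 2 < d`; far away
boundedness of `S` and `b > d` suffice. -/
theorem integrable_norm_rpow_mul (hd : 1 ≤ finrank ℝ E) {S : E → ℝ} (hS : Continuous S)
    {b C M δ : ℝ} (hb : finrank ℝ E < b) (hb2 : b < finrank ℝ E + 2) (hδ : 0 < δ)
    (hC : ∀ z, ‖z‖ < δ → |S z| ≤ C * ‖z‖ ^ 2) (hM : ∀ z, |S z| ≤ M) :
    Integrable (fun z => ‖z‖ ^ (-b) * S z) μ := by
  have hm : AEStronglyMeasurable (fun z => ‖z‖ ^ (-b) * S z) μ :=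
    (measurable_norm.pow_const _).aestronglyMeasurable.mul hS.aestronglyMeasurable
  rw [← integrableOn_univ, ← Set.union_compl_self (Metric.ball (0 : E) δ)]
  refine IntegrableOn.union ?_ ?_
  · refine integrableOn_ball_of_norm_le_rpow hd (α := b - 2) (C := C) (by linarith) ?_ hm
    filter_upwards [ae_restrict_mem Metric.isOpen_ball.measurableSet] with z hz
    have hz : ‖z‖ < δ := by simpa using hz
    rcases eq_or_ne z 0 with rfl | h0
    · have : S 0 = 0 := by simpa using hC 0 (by simpa using hδ)
      rw [this, mul_zero, norm_zero, norm_zero]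
      have hC0 : 0 ≤ C := by
        have : Nontrivial E := Module.nontrivial_of_finrank_pos (R := ℝ) (by omega)
        obtain ⟨y, hy⟩ := exists_norm_eq E (c := δ / 2) (by positivity)
        have := (abs_nonneg _).trans (hC y (by linarith))
        rw [hy] at this
        exact nonneg_of_mul_nonneg_left this (by positivity)
      positivity
    · have hz0 : 0 < ‖z‖ := norm_pos_iff.2 h0
      rw [norm_mul, Real.norm_of_nonneg (by positivity), Real.norm_eq_abs,
        show -(b - 2) = -b + (2 : ℕ) by push_cast; ring, Real.rpow_add_natCast hz0.ne']
      calc _ ≤ ‖z‖ ^ (-b) * (C * ‖z‖ ^ 2) := by gcongr; exact hC z hz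
        _ = _ := by ring
  · refine ((integrableOn_norm_rpow_compl_ball hb hδ).const_mul M).mono' hm.restrict ?_
    refine Eventually.of_forall fun z => ?_
    rw [norm_mul, Real.norm_of_nonneg (by positivity), Real.norm_eq_abs, mul_comm]
    gcongr
    exact hM z

end PowerIntegrability

/-! ### The smoothed kernel and its Laplacian -/

section RegularizedKernel

variable {E : Type*} [NormedAddCommGroup E] [InnerProductSpace ℝ E]

/-- The smooth approximation `(‖z‖² + c) ^ (-a / 2)` of the kernel `‖z‖ ^ (-a)`. -/
noncomputable def regKernel (a c : ℝ) (z : E) : ℝ := (‖z‖ ^ 2 + c) ^ (-a / 2)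

/-- The radial profile of the Laplacian of `regKernel a c` in dimension `d`. -/
noncomputable def regKernelLaplacian (d a c r : ℝ) : ℝ :=
  -a * (r ^ 2 + c) ^ (-a / 2 - 2) * ((d - a - 2) * r ^ 2 + d * c)

theorem contDiff_regKernel {a c : ℝ} (hc : 0 < c) : ContDiff ℝ 2 (regKernel (E := E) a c) :=
  contDiff_iff_contDiffAt.2 fun _ => contDiffAt_norm_sq_add_rpow (by positivity)

variable [FiniteDimensional ℝ E]

theorem laplacian_regKernel {a c : ℝ} {z : E} (hz : 0 < ‖z‖ ^ 2 + c) :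
    Δ (regKernel (E := E) a c) z = regKernelLaplacian (finrank ℝ E) a c ‖z‖ := by
  unfold regKernel regKernelLaplacian
  rw [laplacian_norm_sq_add_rpow hz]
  ring_nf

theorem regKernelLaplacian_zero_right {d a r : ℝ} (hr : 0 < r) :
    regKernelLaplacian d a 0 r = a * (a + 2 - d) * r ^ (-(a + 2)) := by
  have h : (r ^ 2 + 0) ^ (-a / 2 - 2) = r ^ (-(a + 2)) * (r ^ 2)⁻¹ := by
    rw [add_zero, ← Real.rpow_natCast, ← Real.rpow_mul hr.le, ← Real.rpow_neg hr.le,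
      ← Real.rpow_add hr]
    congr 1
    push_cast
    ring
  rw [regKernelLaplacian, h]
  field_simp
  ring

/-- The bound does not depend on `c`, as domination in the limit `c → 0` requires: negative powers
of `r² + c` are largest at `c = 0`. -/
theorem abs_regKernelLaplacian_le {d a c r : ℝ} (hd : 0 ≤ d) (ha : 0 < a) (hc : 0 ≤ c)
    (hr : 0 < r) : |regKernelLaplacian d a c r| ≤ a * (d + a + 2) * r ^ (-(a + 2)) := by
  have h0 : 0 < r ^ 2 + c := by positivity
  have h1 : |(d - a - 2) * r ^ 2 + d * c| ≤ (d + a + 2) * (r ^ 2 + c) := by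
    rw [abs_le]
    constructor <;> nlinarith [sq_nonneg r, mul_nonneg hd (sq_nonneg r), mul_nonneg hd hc,
      mul_nonneg ha.le (sq_nonneg r), mul_nonneg ha.le hc]
  have h2 : (r ^ 2 + c) ^ (-a / 2 - 2) * (r ^ 2 + c) = (r ^ 2 + c) ^ (-a / 2 - 1) := by
    rw [← Real.rpow_add_one h0.ne']
    ring_nf
  have h3 : (r ^ 2 + c) ^ (-a / 2 - 1) ≤ r ^ (-(a + 2)) := by
    have : r ^ (-(a + 2)) = (r ^ 2) ^ (-a / 2 - 1) := by
      rw [← Real.rpow_natCast, ← Real.rpow_mul hr.le]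
      congr 1
      push_cast
      ring
    rw [this]
    exact Real.rpow_le_rpow_of_nonpos (by positivity) (by linarith) (by linarith)
  rw [regKernelLaplacian, abs_mul, abs_mul, abs_neg, abs_of_pos ha,
    abs_of_pos (Real.rpow_pos_of_pos h0 _)]
  calc _ ≤ a * (r ^ 2 + c) ^ (-a / 2 - 2) * ((d + a + 2) * (r ^ 2 + c)) := by gcongr
    _ = a * (d + a + 2) * ((r ^ 2 + c) ^ (-a / 2 - 2) * (r ^ 2 + c)) := by ring
    _ ≤ _ := by rw [h2]; gcongr

variable [MeasurableSpace E] [BorelSpace E] {μ : Measure E} [μ.IsAddHaarMeasure]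

theorem integrable_laplacian_regKernel {a c : ℝ} (ha : 0 < a)
    (had : finrank ℝ E < a + 2) (hc : 0 < c) : Integrable (Δ (regKernel (E := E) a c)) μ := by
  have hcont : Continuous (Δ (regKernel (E := E) a c)) :=
    (contDiff_regKernel hc).continuous_laplacian
  rw [← integrableOn_univ, ← Set.union_compl_self (Metric.ball (0 : E) 1)]
  refine IntegrableOn.union ?_ ?_
  · exact (hcont.continuousOn.integrableOn_compact (isCompact_closedBall 0 1)).mono_set
      Metric.ball_subset_closedBall
  · refine ((integrableOn_norm_rpow_compl_ball had one_pos).const_mul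
      (a * (finrank ℝ E + a + 2))).mono' hcont.aestronglyMeasurable.restrict ?_
    filter_upwards [ae_restrict_mem Metric.isOpen_ball.measurableSet.compl] with z hz
    have hz : 1 ≤ ‖z‖ := by simpa using hz
    rw [laplacian_regKernel (by positivity)]
    exact abs_regKernelLaplacian_le (by positivity) ha hc.le (by positivity)

/-- Divergence theorem in polar form: `r^(d-1)` times the profile is the derivative of the flux
`r^(d-1) ∂ᵣ (r² + c)^(-a/2)`, which vanishes at `0` and, being `O(r^(d-a-2))`, at infinity. -/
theorem integral_laplacian_regKernel (hd : 1 ≤ finrank ℝ E) {a c : ℝ} (ha : 0 < a)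
    (had : finrank ℝ E < a + 2) (hc : 0 < c) :
    ∫ z, Δ (regKernel (E := E) a c) z ∂μ = 0 := by
  have : Nontrivial E := Module.nontrivial_of_finrank_pos (R := ℝ) (by omega)
  have hint := integrable_laplacian_regKernel (E := E) (μ := μ) ha had hc
  have heq : Δ (regKernel (E := E) a c) = fun z => regKernelLaplacian (finrank ℝ E) a c ‖z‖ :=
    funext fun z => laplacian_regKernel (by positivity)
  rw [heq] at hint ⊢
  rw [integrable_fun_norm_addHaar] at hint
  rw [integral_fun_norm_addHaar]
  set d := finrank ℝ E
  have hder : ∀ r ∈ Set.Ici (0 : ℝ), HasDerivAt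
      (fun r : ℝ => -a * (r ^ d * (r ^ 2 + c) ^ (-a / 2 - 1)))
      (r ^ (d - 1) • regKernelLaplacian d a c r) r := by
    intro r _
    have h0 : 0 < r ^ 2 + c := by positivity
    have h1 : HasDerivAt (fun r : ℝ => r ^ 2 + c) (2 * r) r := by
      simpa using (hasDerivAt_pow 2 r).add_const c
    have h2 := (((hasDerivAt_pow d r).mul (h1.rpow_const (p := -a / 2 - 1) (Or.inl h0.ne'))).const_mul
      (-a))
    convert! h2 using 1
    have e1 : (r ^ 2 + c) ^ (-a / 2 - 1) = (r ^ 2 + c) ^ (-a / 2 - 2) * (r ^ 2 + c) := by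
      rw [← Real.rpow_add_one h0.ne']; ring_nf
    have e2 : r ^ d = r ^ (d - 1) * r := by rw [← pow_succ, Nat.sub_add_cancel hd]
    rw [smul_eq_mul, regKernelLaplacian, show -a / 2 - 1 - 1 = -a / 2 - 2 by ring, e1, e2]
    ring
  have hlim : Tendsto (fun r : ℝ => -a * (r ^ d * (r ^ 2 + c) ^ (-a / 2 - 1))) atTop (𝓝 0) := by
    rw [← mul_zero (-a)]
    refine Tendsto.const_mul _ ?_
    refine squeeze_zero' (g := fun r : ℝ => r ^ (-(a + 2 - d))) ?_ ?_
      (tendsto_rpow_neg_atTop (by linarith))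
    · filter_upwards [eventually_gt_atTop 0] with r hr
      positivity
    · filter_upwards [eventually_gt_atTop 0] with r hr
      have e : r ^ (-(a + 2 - d)) = r ^ d * (r ^ 2) ^ (-a / 2 - 1) := by
        rw [← Real.rpow_natCast r d, ← Real.rpow_natCast r 2, ← Real.rpow_mul hr.le,
          ← Real.rpow_add hr]
        congr 1
        push_cast
        ring
      rw [e]
      gcongr ?_ * ?_
      exact Real.rpow_le_rpow_of_nonpos (by positivity) (by linarith) (by linarith)
  rw [integral_Ioi_of_hasDerivAt_of_tendsto' hder hint hlim]
  simp [show d ≠ 0 by omega]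

end RegularizedKernel

/-! ### The potential of a C² function of compact support -/

section PotentialOfSmooth

variable {E : Type*} [NormedAddCommGroup E] [InnerProductSpace ℝ E] [FiniteDimensional ℝ E]
  [MeasurableSpace E] [BorelSpace E] {μ : Measure E} [μ.IsAddHaarMeasure]

/-- After integration by parts, evenness of the kernel lets `v(x - z)` be averaged with `v(x + z)`,
whence the factor `1/2`; subtracting `2 v(x)` costs nothing because the kernel's Laplacian has
integral zero. -/
theorem integral_regKernel_mul_laplacian (hd : 1 ≤ finrank ℝ E) {a c : ℝ} (ha : 0 < a)
    (had : finrank ℝ E < a + 2) (hc : 0 < c) {v : E → ℝ} (hv : ContDiff ℝ 2 v)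
    (hvc : HasCompactSupport v) (x : E) :
    ∫ z, regKernel a c z * Δ v (x - z) ∂μ =
      1 / 2 * ∫ z, regKernelLaplacian (finrank ℝ E) a c ‖z‖ * secondDifference v x z ∂μ := by
  have hK : (fun z : E => regKernelLaplacian (finrank ℝ E) a c ‖z‖) = Δ (regKernel a c) :=
    funext fun z => (laplacian_regKernel (by positivity)).symm
  have hi : Integrable (fun z : E => regKernelLaplacian (finrank ℝ E) a c ‖z‖) μ := by
    rw [hK]; exact integrable_laplacian_regKernel ha had hc
  have hi0 : ∫ z : E, regKernelLaplacian (finrank ℝ E) a c ‖z‖ ∂μ = 0 := by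
    rw [hK]; exact integral_laplacian_regKernel hd ha had hc
  obtain ⟨M, hM⟩ := hv.continuous.bounded_above_of_compact_support hvc
  have hs : ContDiff ℝ 2 fun z => v (x - z) := hv.comp (contDiff_const.sub contDiff_id)
  have hsc : HasCompactSupport fun z => v (x - z) :=
    hvc.comp_homeomorph (Homeomorph.subLeft x)
  have i1 : Integrable (fun z => regKernelLaplacian (finrank ℝ E) a c ‖z‖ * v (x - z)) μ :=
    hi.mul_bdd hs.continuous.aestronglyMeasurable (Eventually.of_forall fun z => hM _)
  have i2 : Integrable (fun z => regKernelLaplacian (finrank ℝ E) a c ‖z‖ * v (x + z)) μ := by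
    simpa using i1.comp_neg
  have i3 := hi.mul_const (2 * v x)
  have e2 : ∫ z, regKernelLaplacian (finrank ℝ E) a c ‖z‖ * v (x + z) ∂μ =
      ∫ z, regKernelLaplacian (finrank ℝ E) a c ‖z‖ * v (x - z) ∂μ := by
    simpa using (integral_neg_eq_self
      (fun z => regKernelLaplacian (finrank ℝ E) a c ‖z‖ * v (x - z)) μ)
  have hS : ∀ z, regKernelLaplacian (finrank ℝ E) a c ‖z‖ * secondDifference v x z =
      regKernelLaplacian (finrank ℝ E) a c ‖z‖ * v (x + z) +
        regKernelLaplacian (finrank ℝ E) a c ‖z‖ * v (x - z) -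
        regKernelLaplacian (finrank ℝ E) a c ‖z‖ * (2 * v x) := fun z => by
    rw [secondDifference]; ring
  simp_rw [hS]
  rw [integral_sub (i2.fun_add i1) i3, integral_add i2 i1, e2, integral_mul_const, hi0]
  simp_rw [← laplacian_comp_const_sub hv x]
  rw [integral_mul_laplacian (contDiff_regKernel hc) hs hsc, ← hK]
  ring

theorem integral_norm_rpow_mul_laplacian (hd : 1 ≤ finrank ℝ E) {a : ℝ} (ha : 0 < a)
    (had : finrank ℝ E < a + 2) (had' : a < finrank ℝ E) {v : E → ℝ} (hv : ContDiff ℝ 2 v)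
    (hvc : HasCompactSupport v) (x : E) :
    ∫ z, ‖z‖ ^ (-a) * Δ v (x - z) ∂μ =
      a * (a + 2 - finrank ℝ E) / 2 *
        ∫ z, ‖z‖ ^ (-(a + 2)) * secondDifference v x z ∂μ := by
  have : Nontrivial E := Module.nontrivial_of_finrank_pos (R := ℝ) (by omega)
  -- The origin is discarded because the real power `0 ^ (-a)` is `0` there and does not dominate
  -- the smoothed kernels.
  have hae : ∀ᵐ z ∂μ, z ≠ (0 : E) := Measure.ae_ne μ 0
  have hΔ := hv.continuous_laplacian
  obtain ⟨M, hM⟩ := hv.continuous.bounded_above_of_compact_support hvc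
  obtain ⟨δ, hδ, C, hC⟩ := exists_abs_secondDifference_le (hv.contDiffAt (x := x))
  have l1 : Tendsto (fun c : ℝ => ∫ z, regKernel a c z * Δ v (x - z) ∂μ) (𝓝[>] 0)
      (𝓝 (∫ z, ‖z‖ ^ (-a) * Δ v (x - z) ∂μ)) := by
    refine tendsto_integral_filter_of_dominated_convergence
      (fun z => ‖‖z‖ ^ (-a) * Δ v (x - z)‖) ?_ ?_ ?_ ?_
    · filter_upwards [self_mem_nhdsWithin] with c hc
      exact ((contDiff_regKernel hc).continuous.mul
        (hΔ.comp (continuous_const.sub continuous_id))).aestronglyMeasurable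
    · filter_upwards [self_mem_nhdsWithin] with c hc
      filter_upwards [hae] with z hz
      have hc : 0 < c := hc
      have hz : 0 < ‖z‖ := norm_pos_iff.2 hz
      rw [norm_mul, norm_mul]
      gcongr
      rw [← norm_sq_rpow_neg_half, regKernel, Real.norm_of_nonneg (by positivity),
        Real.norm_of_nonneg (by positivity)]
      exact Real.rpow_le_rpow_of_nonpos (by positivity) (by linarith) (by linarith)
    · exact ((hvc.laplacian).convolutionExists_right (ContinuousLinearMap.mul ℝ ℝ)
        (locallyIntegrable_norm_rpow_neg hd had') hΔ x).norm
    · filter_upwards [hae] with z hz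
      have hz : 0 < ‖z‖ := norm_pos_iff.2 hz
      refine Tendsto.mul_const _ ?_
      rw [← norm_sq_rpow_neg_half]
      refine Tendsto.mono_left ?_ nhdsWithin_le_nhds
      have : ContinuousAt (fun c : ℝ => (‖z‖ ^ 2 + c) ^ (-a / 2)) 0 :=
        (by fun_prop : ContinuousAt (fun c : ℝ => ‖z‖ ^ 2 + c) 0).rpow_const
          (Or.inl (by positivity))
      exact this.tendsto
  have l2 : Tendsto (fun c : ℝ => ∫ z, regKernelLaplacian (finrank ℝ E) a c ‖z‖ *
      secondDifference v x z ∂μ) (𝓝[>] 0)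
      (𝓝 (∫ z, a * (a + 2 - finrank ℝ E) * (‖z‖ ^ (-(a + 2)) * secondDifference v x z) ∂μ)) := by
    refine tendsto_integral_filter_of_dominated_convergence
      (fun z => a * (finrank ℝ E + a + 2) * ‖‖z‖ ^ (-(a + 2)) * secondDifference v x z‖) ?_ ?_ ?_ ?_
    · filter_upwards [self_mem_nhdsWithin] with c hc
      have hK : (fun z : E => regKernelLaplacian (finrank ℝ E) a c ‖z‖) = Δ (regKernel a c) :=
        funext fun z => (laplacian_regKernel (add_pos_of_nonneg_of_pos (by positivity) hc)).symm
      refine Continuous.aestronglyMeasurable (Continuous.mul ?_ (hv.continuous.secondDifference x))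
      rw [hK]
      exact (contDiff_regKernel hc).continuous_laplacian
    · filter_upwards [self_mem_nhdsWithin] with c hc
      filter_upwards [hae] with z hz
      have hc : 0 < c := hc
      rw [norm_mul, norm_mul, ← mul_assoc, Real.norm_of_nonneg (r := ‖z‖ ^ (-(a + 2))) (by positivity)]
      gcongr
      exact abs_regKernelLaplacian_le (by positivity) ha hc.le (norm_pos_iff.2 hz)
    · exact (integrable_norm_rpow_mul hd (hv.continuous.secondDifference x) had (by linarith) hδ hC
        (abs_secondDifference_le hM x)).norm.const_mul _
    · filter_upwards [hae] with z hz
      have hz : 0 < ‖z‖ := norm_pos_iff.2 hz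
      rw [← mul_assoc, ← regKernelLaplacian_zero_right hz]
      refine Tendsto.mul_const _ ?_
      refine Tendsto.mono_left ?_ nhdsWithin_le_nhds
      have : ContinuousAt (fun c : ℝ => regKernelLaplacian (finrank ℝ E) a c ‖z‖) 0 := by
        unfold regKernelLaplacian
        refine ((continuousAt_const.mul ?_).mul (by fun_prop))
        exact (by fun_prop : ContinuousAt (fun c : ℝ => ‖z‖ ^ 2 + c) 0).rpow_const
          (Or.inl (by positivity))
      exact this.tendsto
  have l3 := tendsto_nhds_unique (l1.congr' (by
    filter_upwards [self_mem_nhdsWithin] with c hc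
    exact integral_regKernel_mul_laplacian hd ha had hc hv hvc x)) (l2.const_mul (1 / 2))
  rw [l3, integral_const_mul]
  ring

end PotentialOfSmooth

/-! ### The potential of a function vanishing near the point -/

section PotentialOfDistant

variable {E : Type*} [NormedAddCommGroup E] [InnerProductSpace ℝ E]

theorem exists_contDiff_eq_norm_rpow_on_annulus [FiniteDimensional ℝ E] (a : ℝ) {r R : ℝ}
    (hr : 0 < r) (hR : 0 < R) :
    ∃ k : E → ℝ, ContDiff ℝ 2 k ∧ HasCompactSupport k ∧
      ∀ z, r ≤ ‖z‖ → ‖z‖ ≤ R → k z = ‖z‖ ^ (-a) := by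
  -- Both bumps equal `1` near the origin, so `g - f` removes the singularity; on the annulus `f =
  -- 0` and `g = 1`.
  let f : ContDiffBump (0 : E) := ⟨r / 2, r, by positivity, by linarith⟩
  let g : ContDiffBump (0 : E) := ⟨max R r, max R r + 1, by positivity, by linarith⟩
  refine ⟨fun z => (g z - f z) * ‖z‖ ^ (-a), ?_, ?_, ?_⟩
  · refine contDiff_iff_contDiffAt.2 fun z => ?_
    rcases eq_or_ne z 0 with rfl | hz
    · refine (contDiffAt_const (c := (0 : ℝ))).congr_of_eventuallyEq ?_
      filter_upwards [g.eventuallyEq_one, f.eventuallyEq_one] with z h1 h2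
      rw [h1, h2, sub_self, zero_mul]
    · exact (g.contDiffAt.sub f.contDiffAt).mul ((contDiffAt_norm ℝ hz).rpow_const_of_ne
        (norm_ne_zero_iff.2 hz))
  · exact (g.hasCompactSupport.sub f.hasCompactSupport).mul_right
  · intro z h1 h2
    have e1 : f z = 0 := f.zero_of_le_dist (by simpa [f] using h1)
    have e2 : g z = 1 := g.one_of_mem_closedBall (by simp [g, h2])
    simp only [e1, e2, sub_zero, one_mul]

variable [FiniteDimensional ℝ E] [MeasurableSpace E] [BorelSpace E] {μ : Measure E}
  [μ.IsAddHaarMeasure]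

/-- For `y` within `δ/2` of `x` and `t` with `w t ≠ 0`, the difference `y - t` stays in a fixed
annulus, where the kernel agrees with a C² function of compact support. -/
theorem contDiffAt_and_laplacian_potential_of_eq_zero_near (a : ℝ)
    {w : E → ℝ} (hw : Continuous w) (hwc : HasCompactSupport w) {x : E} {δ : ℝ} (hδ : 0 < δ)
    (hw0 : ∀ y, ‖x - y‖ < δ → w y = 0) :
    ContDiffAt ℝ 2 (fun y => ∫ t, ‖y - t‖ ^ (-a) * w t ∂μ) x ∧
    Δ (fun y => ∫ t, ‖y - t‖ ^ (-a) * w t ∂μ) x =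
      a * (a + 2 - finrank ℝ E) * ∫ t, ‖x - t‖ ^ (-(a + 2)) * w t ∂μ := by
  obtain ⟨R, hR0, hR⟩ : ∃ R > 0, ∀ t, w t ≠ 0 → ‖x - t‖ ≤ R := by
    obtain ⟨R, hR⟩ := hwc.isCompact.isBounded.subset_closedBall x
    refine ⟨max R 1, by positivity, fun t ht => ?_⟩
    have := hR (subset_tsupport w ht)
    rw [Metric.mem_closedBall, dist_comm, dist_eq_norm] at this
    exact this.trans (le_max_left _ _)
  obtain ⟨k, hk, hkc, hkeq⟩ := exists_contDiff_eq_norm_rpow_on_annulus (E := E) a (r := δ / 2)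
    (R := R + δ) (by positivity) (by positivity)
  have hwl : LocallyIntegrable w μ := hw.locallyIntegrable
  have heq : (fun y => ∫ t, ‖y - t‖ ^ (-a) * w t ∂μ) =ᶠ[𝓝 x]
      (w ⋆[ContinuousLinearMap.mul ℝ ℝ, μ] k) := by
    filter_upwards [Metric.ball_mem_nhds x (half_pos hδ)] with y hy
    rw [Metric.mem_ball, dist_eq_norm] at hy
    refine integral_congr_ae (Eventually.of_forall fun t => ?_)
    change _ = w t * k (y - t)
    by_cases ht : w t = 0
    · simp [ht]
    · have h1 : δ ≤ ‖x - t‖ := not_lt.1 fun h => ht (hw0 t h)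
      have h2 := hR t ht
      have h3 := norm_sub_norm_le (x - t) (x - y)
      have h4 := norm_add_le (x - t) (y - x)
      rw [show x - t - (x - y) = y - t by abel, norm_sub_rev x y] at h3
      rw [show x - t + (y - x) = y - t by abel] at h4
      rw [hkeq _ (by linarith) (by linarith), mul_comm]
  have h2 : ContDiff ℝ 2 (w ⋆[ContinuousLinearMap.mul ℝ ℝ, μ] k) :=
    hkc.contDiff_convolution_right (n := 2) _ hwl hk
  refine ⟨h2.contDiffAt.congr_of_eventuallyEq heq, ?_⟩
  rw [(InnerProductSpace.laplacian_congr_nhds heq).self_of_nhds,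
    laplacian_convolution_mul hwl hk hkc, ← integral_const_mul]
  refine integral_congr_ae (Eventually.of_forall fun t => ?_)
  change w t * Δ k (x - t) = _
  by_cases ht : w t = 0
  · simp [ht]
  · have h1 : δ ≤ ‖x - t‖ := not_lt.1 fun h => ht (hw0 t h)
    have h3 := hR t ht
    have hk' : k =ᶠ[𝓝 (x - t)] regKernel a 0 := by
      filter_upwards [continuous_norm.continuousAt.eventually
        (Ioo_mem_nhds (a := δ / 2) (b := R + δ) (by linarith) (by linarith))] with z hz
      rw [hkeq z hz.1.le hz.2.le, regKernel, norm_sq_rpow_neg_half]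
    have h0 : 0 < ‖x - t‖ := hδ.trans_le h1
    rw [(InnerProductSpace.laplacian_congr_nhds hk').self_of_nhds,
      laplacian_regKernel (by positivity), regKernelLaplacian_zero_right h0]
    ring

end PotentialOfDistant

/-! ### Localisation and the Laplacian of the potential -/

section Potential

variable {E : Type*} [NormedAddCommGroup E]

theorem exists_eq_contDiff_add_eq_zero_near [InnerProductSpace ℝ E] [FiniteDimensional ℝ E]
    {u : E → ℝ} {x : E} (hu : Continuous u) (huc : HasCompactSupport u)
    (hux : ContDiffAt ℝ 2 u x) :
    ∃ v w : E → ℝ, ContDiff ℝ 2 v ∧ HasCompactSupport v ∧ Continuous w ∧ HasCompactSupport w ∧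
      (∃ δ > 0, ∀ y, ‖x - y‖ < δ → w y = 0) ∧ u = fun y => v y + w y := by
  obtain ⟨ε, hε, hball⟩ := Metric.mem_nhds_iff.1 (hux.eventually (by simp))
  let f : ContDiffBump x := ⟨ε / 4, ε / 2, by positivity, by linarith⟩
  have hf : Continuous f := f.contDiff.continuous (n := 2)
  refine ⟨fun y => f y * u y, fun y => (1 - f y) * u y, ?_, huc.mul_left,
    (continuous_const.sub hf).mul hu, huc.mul_left, ⟨ε / 4, by positivity, fun y hy => ?_⟩,
    by ext y; ring⟩
  · refine contDiff_iff_contDiffAt.2 fun y => ?_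
    by_cases hy : y ∈ Metric.ball x ε
    · exact f.contDiffAt.mul (hball hy)
    · refine (contDiffAt_const (c := (0 : ℝ))).congr_of_eventuallyEq ?_
      have hy' : ε / 2 < dist y x := by
        have : ε ≤ dist y x := by simpa using hy
        linarith
      filter_upwards [(continuous_id.dist continuous_const).continuousAt.eventually
        (lt_mem_nhds hy')] with t ht
      rw [f.zero_of_le_dist (show ε / 2 ≤ dist t x from le_of_lt ht), zero_mul]
  · have : f y = 1 := f.one_of_mem_closedBall (by
      rw [Metric.mem_closedBall, dist_comm, dist_eq_norm]; exact hy.le)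
    simp [this]

variable [MeasurableSpace E] [BorelSpace E] {μ : Measure E}

theorem integrable_norm_rpow_mul_of_hasCompactSupport [NormedSpace ℝ E] [FiniteDimensional ℝ E]
    [μ.IsAddHaarMeasure] (hd : 1 ≤ finrank ℝ E) {a : ℝ} (ha : a < finrank ℝ E) {u : E → ℝ}
    (hu : Continuous u) (huc : HasCompactSupport u) (x : E) :
    Integrable (fun t => ‖x - t‖ ^ (-a) * u t) μ := by
  have h : Integrable (fun t => ‖t‖ ^ (-a) * u (x - t)) μ :=
    huc.convolutionExists_right (ContinuousLinearMap.mul ℝ ℝ)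
      (locallyIntegrable_norm_rpow_neg hd ha) hu x
  simpa using h.comp_sub_left x

/-- Since `w x = 0`, only the two translates remain, and `z ↦ -z` makes their integrals equal. This
puts the distant part in the same form as the smooth part. -/
theorem integral_norm_rpow_mul_secondDifference_of_eq_zero_near [NormedSpace ℝ E]
    [FiniteDimensional ℝ E] [μ.IsAddHaarMeasure] (hd : 1 ≤ finrank ℝ E) {b : ℝ}
    (hb : finrank ℝ E < b) (hb2 : b < finrank ℝ E + 2) {w : E → ℝ} (hw : Continuous w)
    (hwc : HasCompactSupport w) {x : E} {δ : ℝ} (hδ : 0 < δ)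
    (hw0 : ∀ y, ‖x - y‖ < δ → w y = 0) :
    ∫ z, ‖z‖ ^ (-b) * secondDifference w x z ∂μ = 2 * ∫ t, ‖x - t‖ ^ (-b) * w t ∂μ := by
  obtain ⟨M, hM⟩ := hw.bounded_above_of_compact_support hwc
  have i1 : Integrable (fun z => ‖z‖ ^ (-b) * w (x - z)) μ :=
    integrable_norm_rpow_mul hd (hw.comp (continuous_const.sub continuous_id)) (C := 0) hb hb2 hδ
      (fun z hz => by simp [hw0 (x - z) (by simpa using hz)]) (fun z => hM (x - z))
  have i2 : Integrable (fun z => ‖z‖ ^ (-b) * w (x + z)) μ := by simpa using i1.comp_neg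
  have e2 : ∫ z, ‖z‖ ^ (-b) * w (x + z) ∂μ = ∫ z, ‖z‖ ^ (-b) * w (x - z) ∂μ := by
    simpa using (integral_neg_eq_self (fun z => ‖z‖ ^ (-b) * w (x - z)) μ)
  have e3 : ∫ z, ‖z‖ ^ (-b) * w (x - z) ∂μ = ∫ t, ‖x - t‖ ^ (-b) * w t ∂μ := by
    simpa using (integral_sub_left_eq_self (fun z => ‖z‖ ^ (-b) * w (x - z)) μ x).symm
  have hx : w x = 0 := hw0 x (by simpa using hδ)
  simp_rw [secondDifference, hx, mul_zero, sub_zero, mul_add]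
  rw [integral_add i2 i1, e2, e3]
  ring

theorem contDiffAt_and_laplacian_potential [InnerProductSpace ℝ E] [FiniteDimensional ℝ E]
    [μ.IsAddHaarMeasure] (hd : 1 ≤ finrank ℝ E) {a : ℝ} (ha : 0 < a)
    (had : finrank ℝ E < a + 2) (had' : a < finrank ℝ E) {u : E → ℝ} {x : E} (hu : Continuous u)
    (huc : HasCompactSupport u) (hux : ContDiffAt ℝ 2 u x) :
    ContDiffAt ℝ 2 (fun y => ∫ t, ‖y - t‖ ^ (-a) * u t ∂μ) x ∧
    Δ (fun y => ∫ t, ‖y - t‖ ^ (-a) * u t ∂μ) x =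
      a * (a + 2 - finrank ℝ E) / 2 *
        ∫ z, ‖z‖ ^ (-(a + 2)) * secondDifference u x z ∂μ := by
  obtain ⟨v, w, hv, hvc, hw, hwc, ⟨δ, hδ, hw0⟩, rfl⟩ :=
    exists_eq_contDiff_add_eq_zero_near hu huc hux
  obtain ⟨hP, hΔ⟩ := contDiffAt_and_laplacian_potential_of_eq_zero_near (μ := μ) a hw hwc hδ hw0
  have hk := locallyIntegrable_norm_rpow_neg (μ := μ) hd had'
  have hsum : (fun y => ∫ t, ‖y - t‖ ^ (-a) * (v t + w t) ∂μ) =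
      ((fun z : E => ‖z‖ ^ (-a)) ⋆[ContinuousLinearMap.mul ℝ ℝ, μ] v) +
        fun y => ∫ t, ‖y - t‖ ^ (-a) * w t ∂μ := by
    ext y
    simp_rw [mul_add]
    rw [integral_add (integrable_norm_rpow_mul_of_hasCompactSupport hd had' hv.continuous hvc y)
      (integrable_norm_rpow_mul_of_hasCompactSupport hd had' hw hwc y), Pi.add_apply]
    congr 1
    change _ = ∫ t, ‖t‖ ^ (-a) * v (y - t) ∂μ
    simpa using (integral_sub_left_eq_self (fun t => ‖t‖ ^ (-a) * v (y - t)) μ y)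
  have hQ : ContDiff ℝ 2 ((fun z : E => ‖z‖ ^ (-a)) ⋆[ContinuousLinearMap.mul ℝ ℝ, μ] v) :=
    hvc.contDiff_convolution_right (n := 2) _ hk hv
  rw [hsum]
  refine ⟨hQ.contDiffAt.add hP, ?_⟩
  rw [hQ.contDiffAt.laplacian_add hP, hΔ, laplacian_convolution_mul hk hv hvc,
    integral_norm_rpow_mul_laplacian hd ha had had' hv hvc]
  have hS : ∀ z, ‖z‖ ^ (-(a + 2)) * secondDifference (fun y => v y + w y) x z =
      ‖z‖ ^ (-(a + 2)) * secondDifference v x z + ‖z‖ ^ (-(a + 2)) * secondDifference w x z :=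
    fun z => by simp only [secondDifference]; ring
  have hint : ∀ f : E → ℝ, Continuous f → HasCompactSupport f → ContDiffAt ℝ 2 f x →
      Integrable (fun z => ‖z‖ ^ (-(a + 2)) * secondDifference f x z) μ := by
    intro f hf hfc hfx
    obtain ⟨M, hM⟩ := hf.bounded_above_of_compact_support hfc
    obtain ⟨η, hη, C, hC⟩ := exists_abs_secondDifference_le hfx
    exact integrable_norm_rpow_mul hd (hf.secondDifference x) had (by linarith) hη hC
      (abs_secondDifference_le hM x)
  have hwx : ContDiffAt ℝ 2 w x := by
    refine (contDiffAt_const (c := (0 : ℝ))).congr_of_eventuallyEq ?_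
    filter_upwards [Metric.ball_mem_nhds x hδ] with y hy
    rw [Metric.mem_ball, dist_comm, dist_eq_norm] at hy
    exact hw0 y hy
  simp_rw [hS]
  rw [integral_add (hint v hv.continuous hvc hv.contDiffAt) (hint w hw hwc hwx),
    integral_norm_rpow_mul_secondDifference_of_eq_zero_near hd had (by linarith) hw hwc hδ hw0]
  ring

end Potential

/-! ### The principal value as an absolutely convergent integral -/

section PrincipalValue

variable {E : Type*} [NormedAddCommGroup E]

theorem indicator_compl_ball_sub_div_norm_rpow (u : E → ℝ) (x : E) (b ε : ℝ) :
    (Metric.ball x ε)ᶜ.indicator (fun y => (u x - u y) / ‖x - y‖ ^ b) = fun y =>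
      (Metric.ball (0 : E) ε)ᶜ.indicator (fun z => ‖z‖ ^ (-b) * (u x - u (x - z))) (x - y) := by
  ext y
  have hmem : y ∈ (Metric.ball x ε)ᶜ ↔ x - y ∈ (Metric.ball (0 : E) ε)ᶜ := by
    simp [dist_comm y x, dist_eq_norm]
  by_cases hy : y ∈ (Metric.ball x ε)ᶜ
  · rw [Set.indicator_of_mem hy, Set.indicator_of_mem (hmem.1 hy), sub_sub_cancel,
      Real.rpow_neg (norm_nonneg _), div_eq_inv_mul]
  · rw [Set.indicator_of_notMem hy, Set.indicator_of_notMem (mt hmem.2 hy)]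

variable [NormedSpace ℝ E] [FiniteDimensional ℝ E] [MeasurableSpace E] [BorelSpace E] {μ : Measure E} [μ.IsAddHaarMeasure]

theorem integrableOn_norm_rpow_mul_sub {b M ε : ℝ} (hb : finrank ℝ E < b) (hε : 0 < ε) {u : E → ℝ}
    (hu : Continuous u) (hM : ∀ y, |u y| ≤ M) (x : E) :
    IntegrableOn (fun z => ‖z‖ ^ (-b) * (u x - u (x - z))) (Metric.ball (0 : E) ε)ᶜ μ := by
  refine (integrableOn_norm_rpow_compl_ball hb hε).mul_bdd (c := 2 * M)
    (by fun_prop) (Eventually.of_forall fun z => ?_)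
  rw [Real.norm_eq_abs, two_mul]
  exact (abs_sub _ _).trans (add_le_add (hM _) (hM _))

theorem integrableOn_sub_div_norm_rpow {b M ε : ℝ} (hb : finrank ℝ E < b) (hε : 0 < ε) {u : E → ℝ}
    (hu : Continuous u) (hM : ∀ y, |u y| ≤ M) (x : E) :
    IntegrableOn (fun y => (u x - u y) / ‖x - y‖ ^ b) (Metric.ball x ε)ᶜ μ := by
  rw [← integrable_indicator_iff Metric.isOpen_ball.measurableSet.compl,
    indicator_compl_ball_sub_div_norm_rpow]
  exact ((integrable_indicator_iff Metric.isOpen_ball.measurableSet.compl).2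
    (integrableOn_norm_rpow_mul_sub hb hε hu hM x)).comp_sub_left x

/-- The excised ball is symmetric, so the integrand may be averaged over `z` and `-z`; this cancels
the first-order term before `ε → 0`. -/
theorem setIntegral_sub_div_norm_rpow {b M ε : ℝ} (hb : finrank ℝ E < b) (hε : 0 < ε) {u : E → ℝ}
    (hu : Continuous u) (hM : ∀ y, |u y| ≤ M) (x : E) :
    ∫ y in (Metric.ball x ε)ᶜ, (u x - u y) / ‖x - y‖ ^ b ∂μ =
      -(1 / 2) * ∫ z in (Metric.ball (0 : E) ε)ᶜ, ‖z‖ ^ (-b) * secondDifference u x z ∂μ := by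
  have hm : MeasurableSet (Metric.ball (0 : E) ε)ᶜ := Metric.isOpen_ball.measurableSet.compl
  set g : E → ℝ := (Metric.ball (0 : E) ε)ᶜ.indicator
    fun z => ‖z‖ ^ (-b) * (u x - u (x - z)) with hg
  have hgi : Integrable g μ :=
    (integrable_indicator_iff hm).2 (integrableOn_norm_rpow_mul_sub hb hε hu hM x)
  have hsum : ∀ z, g z + g (-z) = -(Metric.ball (0 : E) ε)ᶜ.indicator
      (fun z => ‖z‖ ^ (-b) * secondDifference u x z) z := by
    intro z
    have hneg : -z ∈ (Metric.ball (0 : E) ε)ᶜ ↔ z ∈ (Metric.ball (0 : E) ε)ᶜ := by simp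
    by_cases hz : z ∈ (Metric.ball (0 : E) ε)ᶜ
    · rw [hg, Set.indicator_of_mem hz, Set.indicator_of_mem (hneg.2 hz), Set.indicator_of_mem hz,
        norm_neg, sub_neg_eq_add, secondDifference]
      ring
    · rw [hg, Set.indicator_of_notMem hz, Set.indicator_of_notMem (mt hneg.1 hz),
        Set.indicator_of_notMem hz]
      simp
  rw [← integral_indicator Metric.isOpen_ball.measurableSet.compl,
    indicator_compl_ball_sub_div_norm_rpow, integral_sub_left_eq_self g μ x,
    ← integral_indicator hm]
  have h1 : ∫ z, (g z + g (-z)) ∂μ = 2 * ∫ z, g z ∂μ := by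
    rw [integral_add hgi hgi.comp_neg, integral_neg_eq_self g μ, two_mul]
  simp_rw [hsum] at h1
  rw [integral_neg] at h1
  linarith

theorem tendsto_setIntegral_sub_div_norm_rpow (hd : 1 ≤ finrank ℝ E) {b M : ℝ}
    (hb : finrank ℝ E < b) (hb2 : b < finrank ℝ E + 2) {u : E → ℝ} (hu : Continuous u)
    (hM : ∀ y, |u y| ≤ M) {x : E} (hux : ContDiffAt ℝ 2 u x) :
    Tendsto (fun ε : ℝ => ∫ y in (Metric.ball x ε)ᶜ, (u x - u y) / ‖x - y‖ ^ b ∂μ) (𝓝[>] 0)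
      (𝓝 (-(1 / 2) * ∫ z, ‖z‖ ^ (-b) * secondDifference u x z ∂μ)) := by
  obtain ⟨δ, hδ, C, hC⟩ := exists_abs_secondDifference_le hux
  have hi : Integrable (fun z => ‖z‖ ^ (-b) * secondDifference u x z) μ :=
    integrable_norm_rpow_mul hd (hu.secondDifference x) hb hb2 hδ hC (abs_secondDifference_le hM x)
  have : Nontrivial E := Module.nontrivial_of_finrank_pos (R := ℝ) (by omega)
  have hlim : Tendsto (fun ε : ℝ => ∫ z in (Metric.ball (0 : E) ε)ᶜ,
      ‖z‖ ^ (-b) * secondDifference u x z ∂μ) (𝓝[>] 0)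
      (𝓝 (∫ z, ‖z‖ ^ (-b) * secondDifference u x z ∂μ)) := by
    simp_rw [← integral_indicator Metric.isOpen_ball.measurableSet.compl]
    refine tendsto_integral_filter_of_dominated_convergence _ ?_ ?_ hi.norm ?_
    · exact Eventually.of_forall fun ε =>
        hi.aestronglyMeasurable.indicator Metric.isOpen_ball.measurableSet.compl
    · exact Eventually.of_forall fun ε => Eventually.of_forall fun z =>
        norm_indicator_le_norm_self _ _
    · filter_upwards [Measure.ae_ne μ 0] with z hz
      refine tendsto_const_nhds.congr' ?_
      filter_upwards [nhdsWithin_le_nhds (gt_mem_nhds (norm_pos_iff.2 hz))] with ε hε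
      rw [Set.indicator_of_mem (by simpa using hε.le)]
  refine (hlim.const_mul _).congr' ?_
  filter_upwards [self_mem_nhdsWithin] with ε hε
  exact (setIntegral_sub_div_norm_rpow hb hε hu hM x).symm

end PrincipalValue

/-! ### Matching the constants, and the conclusion -/

theorem fracLapConst_eq_neg_weakConst_mul {n : ℕ} (hn : 2 ≤ n) {s : ℝ} (hs0 : 0 < s)
    (hs1 : s < 1) : fracLapConst n s = -weakConst n s * ((n + 2 * s - 2) * (2 * s)) := by
  have hn' : (2 : ℝ) ≤ n := by exact_mod_cast hn
  have hsin : 0 < Real.sin (Real.pi * s) := Real.sin_pos_of_pos_of_lt_pi (by positivity)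
    (by nlinarith [Real.pi_pos])
  have h1 : Real.Gamma (s + n / 2) = (s + n / 2 - 1) * Real.Gamma (s + n / 2 - 1) := by
    have := Real.Gamma_add_one (s := s + n / 2 - 1) (by linarith)
    rwa [sub_add_cancel] at this
  have h2 : Real.Gamma s = Real.pi / (Real.sin (Real.pi * s) * Real.Gamma (1 - s)) := by
    have h := Real.Gamma_mul_Gamma_one_sub s
    have hG : 0 < Real.Gamma (1 - s) := Real.Gamma_pos_of_pos (by linarith)
    rw [eq_div_iff hsin.ne'] at h
    rw [eq_div_iff (by positivity)]
    linear_combination h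
  have h3 : (4 : ℝ) ^ (1 - s) = 4 / 2 ^ (2 * s) := by
    rw [Real.rpow_sub (by norm_num), Real.rpow_one, Real.rpow_mul (by norm_num)]
    norm_num
  have h4 : Real.pi ^ ((n : ℝ) / 2 + 1) = Real.pi ^ ((n : ℝ) / 2) * Real.pi :=
    Real.rpow_add_one Real.pi_pos.ne' _
  have hG : 0 < Real.Gamma (1 - s) := Real.Gamma_pos_of_pos (by linarith)
  rw [fracLapConst, weakConst, h1, h2, h3, h4]
  generalize Real.sin (Real.pi * s) = S at hsin
  field_simp
  ring

theorem theorem3p1 (n : ℕ) (hn : 2 ≤ n) (s : ℝ) (hs0 : 0 < s) (hs1 : s < 1)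
    (Ω : Set (EuclideanSpace ℝ (Fin n))) (hΩ : IsBoundedLipschitzDomain Ω)
    (u : EuclideanSpace ℝ (Fin n) → ℝ)
    (hu2 : ContDiffOn ℝ 2 u Ω) (huc : Continuous u)
    (hu0 : ∀ x, x ∉ Ω → u x = 0)
    (hui : ∀ i : Fin n,
      IntegrableOn (fun y => fderiv ℝ u y (EuclideanSpace.single i (1 : ℝ))) Ω) :
    ∀ x : EuclideanSpace ℝ (Fin n), x ∉ frontier Ω →
      IntegrableOn (fun y => u y / ‖x - y‖ ^ ((n : ℝ) + 2 * s - 2)) Ω ∧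
      ContDiffAt ℝ 2 (weakPotential s Ω u) x ∧
      HasFracLaplacianAt s u x (weakConst n s * Laplacian.laplacian (weakPotential s Ω u) x) := by
  have hn' : (2 : ℝ) ≤ n := by exact_mod_cast hn
  have hfin : finrank ℝ (EuclideanSpace ℝ (Fin n)) = n := finrank_euclideanSpace_fin
  have hd : 1 ≤ finrank ℝ (EuclideanSpace ℝ (Fin n)) := by omega
  have hd' : (finrank ℝ (EuclideanSpace ℝ (Fin n)) : ℝ) = n := by rw [hfin]
  have hcs : HasCompactSupport u :=
    HasCompactSupport.of_support_subset_isCompact hΩ.2.1.isCompact_closure fun y hy =>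
      subset_closure (by_contra fun h => hy (hu0 y h))
  obtain ⟨M, hM⟩ := huc.bounded_above_of_compact_support hcs
  intro x hx
  have hux : ContDiffAt ℝ 2 u x := by
    by_cases hxΩ : x ∈ Ω
    · exact hu2.contDiffAt (hΩ.1.mem_nhds hxΩ)
    · have hxc : x ∉ closure Ω := fun h => hx ⟨h, fun h' => hxΩ (interior_subset h')⟩
      refine (contDiffAt_const (c := (0 : ℝ))).congr_of_eventuallyEq ?_
      filter_upwards [isClosed_closure.isOpen_compl.mem_nhds hxc] with y hy
      exact hu0 y fun h => hy (subset_closure h)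
  set a : ℝ := n + 2 * s - 2 with ha
  have hrw : ∀ y t : EuclideanSpace ℝ (Fin n), u t / ‖y - t‖ ^ a = ‖y - t‖ ^ (-a) * u t :=
    fun y t => by rw [Real.rpow_neg (norm_nonneg _), div_eq_inv_mul]
  have hpot : weakPotential s Ω u = fun y => ∫ t, ‖y - t‖ ^ (-a) * u t := by
    ext y
    rw [weakPotential, setIntegral_eq_integral_of_forall_compl_eq_zero
      fun t ht => by rw [hu0 t ht, zero_div]]
    exact integral_congr_ae (Eventually.of_forall (hrw y))
  -- Here `0 < a` comes from `n ≥ 2` and `s > 0`, `n < a + 2` from `s > 0`, and `a < n` from `s <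
  -- 1`.
  obtain ⟨hP, hΔ⟩ := contDiffAt_and_laplacian_potential (μ := volume) hd (a := a) (by linarith)
    (by linarith) (by linarith) huc hcs hux
  rw [← hpot] at hP hΔ
  refine ⟨?_, hP, fun ε hε => ?_, ?_⟩
  · simp_rw [hrw x]
    exact (integrable_norm_rpow_mul_of_hasCompactSupport hd (by linarith) huc hcs x).integrableOn
  · exact integrableOn_sub_div_norm_rpow (by linarith) hε huc hM x
  · rw [hΔ, fracLapConst_eq_neg_weakConst_mul hn hs0 hs1, hd']
    -- Both constants in front of the second-difference integral equal `weakConst n s * a * s`,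
    -- because `a + 2 - n = 2 * s`.
    convert (tendsto_setIntegral_sub_div_norm_rpow (μ := volume) hd (b := n + 2 * s) (by linarith)
      (by linarith) huc hM hux).const_mul _ using 2
    rw [show a + 2 = n + 2 * s by rw [ha]; ring]
    ring
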